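/- Let $\kappa\ge 1$ be an integer, let $\delta$ be a real number with $\delta \ge \frac{2\cosh\pi}{\cosh\pi-1}$, and define $\psi\colon\mathbb R\to\mathbb R$ by $\psi(x)=\cosh x+\cos x+\delta$. On $\mathbb R^\kappa$ with the Euclidean norm $\|\cdot\|$ let $\rho(x)=\psi(\|x\|)^{-1}$ and let $\mu_\rho$ be the Borel measure $d\mu_\rho=\rho\,dV_\kappa$, where $V_\kappa$ is Lebesgue measure. For $a\in\mathbb R^\kappa$ let $C_{I+a,\rho}$ denote the composition operator $f\mapsto f(\cdot+a)$ in the complex Hilbert space $L^2(\mu_\rho)$. Recall that a bounded operator $S$ on a complex Hilbert space $H$ is hyponormal if $SS^*\le S^*S$, subnormal if there are a complex Hilbert space $K$, an isometric embedding $H\subseteq K$ and a bounded normal operator $N$ on $K$ with $Sh=Nh$ for all $h\in H$, and cohyponormal (resp. cosubnormal) if $S^*$ is hyponormal (resp. subnormal). Let $\mathscr H_4$ be the class of entire functions of the form $\Phi(z)=\alpha_0+\sum_{n\ge4}\alpha_nz^n$ ($z\in\mathbb C$) with $\alpha_0\ge0$, $\alpha_4>0$ and $\alpha_n\ge0$ for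 $n\ge5$; a function on $\mathbb R$ is said to belong to $\mathscr H_4$ if it extends to such an entire function. Then: (i) $\psi$ takes values in $(0,\infty)$, is continuous and even, and $\psi\in\mathscr H_4$; (ii) for every $a\in\mathbb R^\kappa$, $C_{I+a,\rho}$ is a bounded operator defined on all of $L^2(\mu_\rho)$, and it is cohyponormal; (iii) there exists $\varepsilon\in(0,\infty)$ such that for every $a\in\mathbb R^\kappa$ with $0<\|a\|<\varepsilon$, the operator $C_{I+a,\rho}$ is not cosubnormal. -/

import Mathlib

open MeasureTheory

noncomputable section

/-- For `k ≥ 1`, the class of entire functions `Φ(z) = α₀ + ∑_{n ≥ k} αₙ zⁿ` with all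
`αₙ ≥ 0` and `α_k > 0` (the power series converges to `Φ` on all of `ℂ`). -/
def classH (k : ℕ) : Set (ℂ → ℂ) :=
  {Φ | 1 ≤ k ∧ ∃ α : ℕ → ℝ, (∀ n, 0 ≤ α n) ∧ (∀ n, 1 ≤ n → n < k → α n = 0) ∧ 0 < α k ∧
    ∀ z : ℂ, HasSum (fun n : ℕ => (α n : ℂ) * z ^ n) (Φ z)}

/-- A function on the real line belongs to the class `H_k` if it extends to an entire function
in this class. -/
def MemClassH (k : ℕ) (ψ : ℝ → ℝ) : Prop :=
  ∃ Φ ∈ classH k, ∀ x : ℝ, Φ (x : ℂ) = (ψ x : ℂ)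

/-- The density `ρ(x) = ψ(‖x‖)⁻¹` on Euclidean space. -/
def radialDensity (κ : ℕ) (ψ : ℝ → ℝ) (x : EuclideanSpace ℝ (Fin κ)) : ℝ :=
  (ψ ‖x‖)⁻¹

/-- The Borel measure `dμ_ρ = ρ dV_κ` on Euclidean space, `V_κ` the Lebesgue measure. -/
def radialMeasure (κ : ℕ) (ψ : ℝ → ℝ) : Measure (EuclideanSpace ℝ (Fin κ)) :=
  volume.withDensity (fun x => ENNReal.ofReal (radialDensity κ ψ x))

/-- The bounded operator `C` on the complex space `L²(μ)` is the composition operator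
`f ↦ f ∘ T`. As `f` runs over all representatives, this contains that `f ∘ T` depends, up to
`μ`-null sets, only on the class of `f`; it determines `C` uniquely. -/
def IsCompositionOperator {X : Type*} [MeasurableSpace X] (μ : Measure X) (T : X → X)
    (C : Lp ℂ 2 μ →L[ℂ] Lp ℂ 2 μ) : Prop :=
  ∀ (f : X → ℂ) (hf : MemLp f 2 μ), (C (hf.toLp f) : X → ℂ) =ᵐ[μ] f ∘ T

section Operators

universe u

variable {H : Type u} [NormedAddCommGroup H] [InnerProductSpace ℂ H] [CompleteSpace H]

/-- `S` is hyponormal if `S S* ≤ S* S` (order of bounded self-adjoint operators). -/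
def IsHyponormal (S : H →L[ℂ] H) : Prop :=
  S ∘L ContinuousLinearMap.adjoint S ≤ ContinuousLinearMap.adjoint S ∘L S

/-- `S` is subnormal if it is the restriction to `H` of a bounded normal operator `N` on a
complex Hilbert space `K` in which `H` is isometrically embedded. -/
def IsSubnormal (S : H →L[ℂ] H) : Prop :=
  ∃ (K : Type u) (_ : NormedAddCommGroup K) (_ : InnerProductSpace ℂ K) (_ : CompleteSpace K)
    (J : H →ₗᵢ[ℂ] K) (N : K →L[ℂ] K), IsStarNormal N ∧ ∀ h : H, J (S h) = N (J h)

/-- `S` is cohyponormal if its adjoint is hyponormal. -/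
def IsCohyponormal (S : H →L[ℂ] H) : Prop :=
  IsHyponormal (ContinuousLinearMap.adjoint S)

/-- `S` is cosubnormal if its adjoint is subnormal. -/
def IsCosubnormal (S : H →L[ℂ] H) : Prop :=
  IsSubnormal (ContinuousLinearMap.adjoint S)

end Operators

end

/-! A change of variables turns `‖C f‖²` and `‖C* f‖²` into integrals of `|f|²` against the weights
`ψ ‖x‖ / ψ ‖x - a‖` and `ψ ‖x + a‖ / ψ ‖x‖`, so both properties of `C` become properties of `ψ`.

Cohyponormality follows from `ψ ‖x‖ ^ 2 ≤ ψ ‖x - a‖ * ψ ‖x + a‖`. This holds because `log ψ` is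
convex, and monotone on `[0, ∞)`; the bound on `δ` is what makes it convex
(`two_mul_sinh_mul_sin_add_nonneg`).

Cosubnormality forces every Hankel matrix `ψ ‖x + (j + k) • a‖` to be positive semidefinite
(`IsCosubnormal.sum_mul_nonneg`). With `x = -3a` and `s = ‖a‖` the entries are `ψ ((j + k - 3) s)`.
The coefficients of a cubic with roots `1, e^s, e^{-s}` annihilate `δ` and `cosh`, leaving only the
contribution of `cos`, which is negative for `0 < s < 2π` (`hankel_cosh_add_cos`). -/

/-! ### Hilbert space criteria for subnormality and cohyponormality. -/

section Operators

open ContinuousLinearMap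

variable {H : Type*} [NormedAddCommGroup H] [InnerProductSpace ℂ H]

/-- Normality gives `(N*N)^n = (N^n)* N^n`, and `N*N` is self-adjoint. -/
lemma inner_pow_star_mul_self_of_isStarNormal [CompleteSpace H] {N : H →L[ℂ] H}
    (hN : IsStarNormal N) (v : H) (j k : ℕ) :
    inner ℂ (((star N * N) ^ j) v) (((star N * N) ^ k) v) = (‖(N ^ (j + k)) v‖ ^ 2 : ℝ) := by
  have hsa : star ((star N * N) ^ j) = (star N * N) ^ j := by simp
  have hp : (star N * N) ^ (j + k) = star (N ^ (j + k)) * N ^ (j + k) := by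
    rw [hN.star_comm_self.mul_pow, star_pow]
  rw [← hsa, star_eq_adjoint ((star N * N) ^ j), adjoint_inner_left, ← mul_apply_eq_comp,
    ← pow_add, hp, mul_apply_eq_comp, star_eq_adjoint, adjoint_inner_right,
    inner_self_eq_norm_sq_to_K]
  norm_cast

/-- The squared norms `‖Sⁿ h‖²` along an orbit of a subnormal operator form a positive
semidefinite Hankel matrix. -/
theorem IsSubnormal.sum_norm_sq_pow_nonneg {S : H →L[ℂ] H} (hS : IsSubnormal S) (h : H)
    (s : Finset ℕ) (c : ℕ → ℝ) :
    0 ≤ ∑ j ∈ s, ∑ k ∈ s, c j * c k * ‖(S ^ (j + k)) h‖ ^ 2 := by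
  obtain ⟨K, _, _, _, J, N, hN, hJ⟩ := hS
  have hpow : ∀ n : ℕ, J ((S ^ n) h) = (N ^ n) (J h) := by
    intro n
    induction n with
    | zero => simp
    | succ n ih => rw [pow_succ', pow_succ', mul_apply_eq_comp, mul_apply_eq_comp, hJ, ih]
  -- The Hankel form is exactly `‖v‖²`.
  set v := ∑ j ∈ s, (c j : ℂ) • ((star N * N) ^ j) (J h) with hv
  have key : inner ℂ v v =
      ((∑ j ∈ s, ∑ k ∈ s, c j * c k * ‖(S ^ (j + k)) h‖ ^ 2 : ℝ) : ℂ) := by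
    rw [hv, sum_inner, Complex.ofReal_sum]
    refine Finset.sum_congr rfl fun j _ => ?_
    rw [inner_sum, Complex.ofReal_sum]
    refine Finset.sum_congr rfl fun k _ => ?_
    rw [inner_smul_left, inner_smul_right, inner_pow_star_mul_self_of_isStarNormal hN, ← hpow,
      J.norm_map, Complex.conj_ofReal]
    push_cast
    ring
  have := inner_self_nonneg (𝕜 := ℂ) (x := v)
  rwa [key, RCLike.re_to_complex, Complex.ofReal_re] at this

theorem isCohyponormal_of_norm_sq_le [CompleteSpace H] {S : H →L[ℂ] H}
    (h : ∀ x, ‖S x‖ ^ 2 ≤ ‖adjoint S x‖ ^ 2) :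
    IsCohyponormal S := by
  rw [IsCohyponormal, IsHyponormal, adjoint_adjoint, ContinuousLinearMap.le_def,
    isPositive_def]
  refine ⟨?_, fun x => ?_⟩
  · rw [← isSelfAdjoint_iff_isSymmetric]
    have h1 : IsSelfAdjoint (S * star S) := .mul_star_self S
    have h2 : IsSelfAdjoint (star S * S) := .star_mul_self S
    exact h1.sub h2
  · rw [reApplyInnerSelf_apply, sub_apply, inner_sub_left, map_sub, comp_apply, comp_apply,
      adjoint_inner_left, ← adjoint_inner_right S, inner_self_eq_norm_sq, inner_self_eq_norm_sq]
    linarith [h x]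

end Operators

/-! ### Real analysis of `cosh x + cos x + δ`. -/

section Function

/-- The `c j` are the coefficients of `p(t) = (t - 1)(t² - 2 cosh s · t + 1)`. A sequence `λ^(n-3)`
contributes `λ^(-3) p(λ)²`, which vanishes at `λ = 1, e^s, e^{-s}`; averaging over `λ = e^{is},
e^{-is}` yields the right-hand side. -/
lemma hankel_cosh_add_cos (δ s : ℝ) (ψ : ℝ → ℝ)
    (hψ : ∀ x : ℝ, ψ x = Real.cosh x + Real.cos x + δ) (c : ℕ → ℝ)
    (h0 : c 0 = -1) (h1 : c 1 = 2 * Real.cosh s + 1) (h2 : c 2 = -(2 * Real.cosh s + 1))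
    (h3 : c 3 = 1) :
    ∑ j ∈ Finset.range 4, ∑ k ∈ Finset.range 4, c j * c k * ψ (((j + k : ℕ) - 3 : ℝ) * s) =
      -8 * (1 - Real.cos s) * (Real.cosh s - Real.cos s) ^ 2 := by
  have e : ∀ x, ψ (-x) = ψ x := fun x => by simp [hψ]
  have a3 : ψ (3 * s) = 4 * Real.cosh s ^ 3 - 3 * Real.cosh s
      + (4 * Real.cos s ^ 3 - 3 * Real.cos s) + δ := by
    rw [hψ, Real.cosh_three_mul, Real.cos_three_mul]
  have a2 : ψ (2 * s) = 2 * Real.cosh s ^ 2 - 1 + (2 * Real.cos s ^ 2 - 1) + δ := by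
    rw [hψ, Real.cosh_two_mul, Real.cos_two_mul, Real.sinh_sq]; ring
  have a0 : ψ 0 = 2 + δ := by rw [hψ]; simp; ring
  simp only [Finset.sum_range_succ, Finset.sum_range_zero, h0, h1, h2, h3]
  norm_num
  rw [e, e, e, a3, a2, a0, hψ s]
  ring

/-- The expression is `ψ ψ'' - ψ'²`, the numerator of `(log ψ)''`. It is even; on `[0, π]` both
terms are nonnegative, and beyond `π` the bound `δ (cosh x - 1) ≥ 2 cosh x > 2 sinh x` takes over.
-/
lemma two_mul_sinh_mul_sin_add_nonneg {δ : ℝ}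
    (hδ : 2 * Real.cosh Real.pi / (Real.cosh Real.pi - 1) ≤ δ) (x : ℝ) :
    0 ≤ 2 * Real.sinh x * Real.sin x + δ * (Real.cosh x - Real.cos x) := by
  have hpi : 1 < Real.cosh Real.pi := Real.one_lt_cosh.2 Real.pi_ne_zero
  have hδ0 : 0 ≤ δ := le_trans (by
    apply div_nonneg <;> linarith) hδ
  rw [div_le_iff₀ (by linarith)] at hδ
  wlog hx : 0 ≤ x generalizing x
  · have := this (-x) (by linarith)
    simpa using this
  have hs : 0 ≤ Real.sinh x := Real.sinh_nonneg_iff.2 hx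
  have hd : Real.cosh x - 1 ≤ Real.cosh x - Real.cos x := by linarith [Real.cos_le_one x]
  have hc1 := Real.one_le_cosh x
  rcases le_total x Real.pi with h | h
  · have h1 := Real.sin_nonneg_of_nonneg_of_le_pi hx h
    have h2 : 0 ≤ Real.cosh x - Real.cos x := by linarith
    positivity
  · have h1 : Real.sinh x * (-1) ≤ Real.sinh x * Real.sin x :=
      mul_le_mul_of_nonneg_left (Real.neg_one_le_sin x) hs
    have h2 : Real.cosh Real.pi ≤ Real.cosh x :=
      Real.cosh_le_cosh.2 (by rwa [abs_of_pos Real.pi_pos, abs_of_nonneg hx])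
    have h3 := Real.sinh_lt_cosh x
    have h4 : δ * (Real.cosh x - 1) ≤ δ * (Real.cosh x - Real.cos x) :=
      mul_le_mul_of_nonneg_left hd hδ0
    have h5 : 2 ≤ δ := by
      by_contra! hlt
      nlinarith
    nlinarith

lemma two_le_of_cosh_pi_div_le {δ : ℝ}
    (hδ : 2 * Real.cosh Real.pi / (Real.cosh Real.pi - 1) ≤ δ) : 2 ≤ δ := by
  have hpi : 1 < Real.cosh Real.pi := Real.one_lt_cosh.2 Real.pi_ne_zero
  refine le_trans ?_ hδ
  rw [le_div_iff₀ (by linarith)]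
  linarith

lemma cosh_add_cos_add_pos {δ : ℝ} (hδ : 2 ≤ δ) (x : ℝ) :
    0 < Real.cosh x + Real.cos x + δ := by
  linarith [Real.one_le_cosh x, Real.neg_one_le_cos x]

lemma hasDerivAt_log_cosh_add_cos {δ : ℝ} (hδ : 2 ≤ δ) (x : ℝ) :
    HasDerivAt (fun x => Real.log (Real.cosh x + Real.cos x + δ))
      ((Real.sinh x - Real.sin x) / (Real.cosh x + Real.cos x + δ)) x := by
  have := (((Real.hasDerivAt_cosh x).add (Real.hasDerivAt_cos x)).add_const δ).log
    (cosh_add_cos_add_pos hδ x).ne'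
  simpa [sub_eq_add_neg] using this

lemma convexOn_log_cosh_add_cos {δ : ℝ}
    (hδ : 2 * Real.cosh Real.pi / (Real.cosh Real.pi - 1) ≤ δ) :
    ConvexOn ℝ Set.univ (fun x => Real.log (Real.cosh x + Real.cos x + δ)) := by
  have h2 := two_le_of_cosh_pi_div_le hδ
  refine Monotone.convexOn_univ_of_deriv
    (fun x => (hasDerivAt_log_cosh_add_cos h2 x).differentiableAt) ?_
  rw [funext fun x => (hasDerivAt_log_cosh_add_cos h2 x).deriv]
  have hd : ∀ x, HasDerivAt
      (fun x => (Real.sinh x - Real.sin x) / (Real.cosh x + Real.cos x + δ))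
      (((Real.cosh x - Real.cos x) * (Real.cosh x + Real.cos x + δ) -
        (Real.sinh x - Real.sin x) * (Real.sinh x + -Real.sin x)) /
        (Real.cosh x + Real.cos x + δ) ^ 2) x := fun x =>
    ((Real.hasDerivAt_sinh x).sub (Real.hasDerivAt_sin x)).div
      (((Real.hasDerivAt_cosh x).add (Real.hasDerivAt_cos x)).add_const δ)
      (cosh_add_cos_add_pos h2 x).ne'
  refine monotone_of_deriv_nonneg (fun x => (hd x).differentiableAt) fun x => ?_
  rw [(hd x).deriv]
  refine div_nonneg ?_ (sq_nonneg _)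
  have h := two_mul_sinh_mul_sin_add_nonneg hδ x
  nlinarith [Real.cosh_sq x, Real.sin_sq_add_cos_sq x]

lemma monotoneOn_log_cosh_add_cos {δ : ℝ} (hδ : 2 ≤ δ) :
    MonotoneOn (fun x => Real.log (Real.cosh x + Real.cos x + δ)) (Set.Ici 0) := by
  have hdiff : Differentiable ℝ (fun x => Real.log (Real.cosh x + Real.cos x + δ)) :=
    fun x => (hasDerivAt_log_cosh_add_cos hδ x).differentiableAt
  refine monotoneOn_of_deriv_nonneg (convex_Ici 0) hdiff.continuous.continuousOn
    hdiff.differentiableOn fun x hx => ?_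
  rw [(hasDerivAt_log_cosh_add_cos hδ x).deriv]
  rw [interior_Ici, Set.mem_Ioi] at hx
  refine div_nonneg ?_ (cosh_add_cos_add_pos hδ x).le
  linarith [Real.self_le_sinh_iff.2 hx.le, Real.sin_le hx.le]

lemma sq_le_mul_cosh_add_cos_norm {E : Type*} [NormedAddCommGroup E] [NormedSpace ℝ E] {δ : ℝ}
    (hδ : 2 * Real.cosh Real.pi / (Real.cosh Real.pi - 1) ≤ δ) (x a : E) :
    (Real.cosh ‖x‖ + Real.cos ‖x‖ + δ) ^ 2 ≤
      (Real.cosh ‖x - a‖ + Real.cos ‖x - a‖ + δ) * (Real.cosh ‖x + a‖ + Real.cos ‖x + a‖ + δ) := by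
  have h2 := two_le_of_cosh_pi_div_le hδ
  have pos := cosh_add_cos_add_pos h2
  -- `x` is the midpoint of `x - a` and `x + a`; monotonicity passes to the mean of the two norms,
  -- where convexity applies.
  have hn : ‖x‖ ≤ (1 / 2 : ℝ) • ‖x - a‖ + (1 / 2 : ℝ) • ‖x + a‖ := by
    have h := norm_add_le (x - a) (x + a)
    rw [sub_add_add_cancel, ← two_smul ℝ x, norm_smul, Real.norm_ofNat] at h
    simp only [smul_eq_mul]
    linarith
  have h1 := monotoneOn_log_cosh_add_cos h2 (norm_nonneg x)
    ((norm_nonneg x).trans hn) hn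
  have h3 := (convexOn_log_cosh_add_cos hδ).2 (Set.mem_univ ‖x - a‖) (Set.mem_univ ‖x + a‖)
    one_half_pos.le one_half_pos.le
    (add_halves 1)
  have h4 := h1.trans h3
  simp only [smul_eq_mul] at h4
  rw [← Real.log_le_log_iff (by have := pos ‖x‖; positivity) (mul_pos (pos _) (pos _)),
    Real.log_mul (pos _).ne' (pos _).ne', Real.log_pow]
  push_cast
  linarith

/-- This bounds the weight `ψ ‖x‖ / ψ ‖x - a‖`, hence makes the composition operator bounded. The
term `2 * cosh ‖a‖` of the constant absorbs `cosh ‖x‖`, the term `2` absorbs `cos ‖x‖ + δ`. -/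
lemma exists_cosh_add_cos_norm_le {E : Type*} [NormedAddCommGroup E] {δ : ℝ} (hδ : 2 ≤ δ) (a : E) :
    ∃ M : ℝ, ∀ x : E, Real.cosh ‖x‖ + Real.cos ‖x‖ + δ ≤
      M * (Real.cosh ‖x - a‖ + Real.cos ‖x - a‖ + δ) := by
  refine ⟨2 * Real.cosh ‖a‖ + 2, fun x => ?_⟩
  have h1 : Real.cosh ‖x‖ ≤ Real.cosh (‖x - a‖ + ‖a‖) := by
    rw [Real.cosh_le_cosh, abs_of_nonneg (norm_nonneg _), abs_of_nonneg (by positivity)]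
    simpa using norm_add_le (x - a) a
  rw [Real.cosh_add] at h1
  have h2 := Real.sinh_lt_cosh ‖x - a‖
  have h3 := Real.sinh_lt_cosh ‖a‖
  have h4 : 0 ≤ Real.sinh ‖x - a‖ := Real.sinh_nonneg_iff.2 (norm_nonneg _)
  have h5 : 0 ≤ Real.sinh ‖a‖ := Real.sinh_nonneg_iff.2 (norm_nonneg _)
  have h6 : Real.sinh ‖x - a‖ * Real.sinh ‖a‖ ≤ Real.cosh ‖x - a‖ * Real.cosh ‖a‖ := by gcongr
  have h7 : Real.cosh ‖x - a‖ ≤ Real.cosh ‖x - a‖ + Real.cos ‖x - a‖ + δ := by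
    linarith [Real.neg_one_le_cos ‖x - a‖]
  have h8 : Real.cosh ‖a‖ * Real.cosh ‖x - a‖ ≤
      Real.cosh ‖a‖ * (Real.cosh ‖x - a‖ + Real.cos ‖x - a‖ + δ) := by gcongr
  have := Real.one_le_cosh ‖x - a‖
  nlinarith [Real.neg_one_le_cos ‖x - a‖, Real.cos_le_one ‖x‖]

lemma memClassH_cosh_add_cos {δ : ℝ} (hδ : 0 ≤ δ) :
    MemClassH 4 (fun x => Real.cosh x + Real.cos x + δ) := by
  refine ⟨fun z => Complex.cosh z + Complex.cos z + δ, ⟨by norm_num,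
    -- In `cosh + cos` the even-degree terms double when `4 ∣ n` and cancel otherwise.
    fun n => (if n = 0 then δ else 0) + if 4 ∣ n then 2 / (n.factorial : ℝ) else 0, fun n => ?_,
    fun n h1 h4 => ?_, ?_, fun z => ?_⟩, fun x => by push_cast; rfl⟩
  · dsimp only
    split_ifs <;> positivity
  · have h0 : n ≠ 0 := by lia
    have : ¬ 4 ∣ n := fun h => by have := Nat.le_of_dvd h1 h; lia
    simp [h0, this]
  · simp; positivity
  · have hinj : Function.Injective (fun n : ℕ => 2 * n) := fun _ _ h => by simpa using h
    have hext : ∀ n, n ∉ Set.range (fun n : ℕ => 2 * n) →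
        (if 4 ∣ n then 2 / (n.factorial : ℂ) else 0) * z ^ n = 0 := by
      intro n hn
      have : ¬ 4 ∣ n := fun ⟨m, h⟩ => hn ⟨2 * m, by dsimp only; lia⟩
      simp [this]
    have hA : HasSum (fun n : ℕ => (if 4 ∣ n then 2 / (n.factorial : ℂ) else 0) * z ^ n)
        (Complex.cosh z + Complex.cos z) := by
      rw [← hinj.hasSum_iff hext]
      convert (Complex.hasSum_cosh z).add (Complex.hasSum_cos z) using 2 with n
      rcases Nat.even_or_odd n with h | h
      · have h4 : 4 ∣ 2 * n := by obtain ⟨m, rfl⟩ := h; exact ⟨m, by lia⟩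
        simp only [Function.comp_apply, h4, if_true, h.neg_one_pow]
        ring
      · have h4 : ¬ 4 ∣ 2 * n := by obtain ⟨m, rfl⟩ := h; lia
        simp only [Function.comp_apply, h4, if_false, h.neg_one_pow]
        ring
    have hB : HasSum (fun n : ℕ => (if n = 0 then (δ : ℂ) else 0) * z ^ n) δ := by
      convert hasSum_ite_eq (0 : ℕ) (δ : ℂ) using 2 with n
      split_ifs with h <;> simp [h]
    convert hB.add hA using 1
    · ext n
      push_cast
      rw [add_mul]
      congr 2 <;> split_ifs <;> simp
    · ring

end Function

/-! ### The weighted measure under translation, and boundedness of the composition operator. -/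

section Measure

open scoped ENNReal

variable {κ : ℕ} {ψ : ℝ → ℝ}

lemma continuous_radialDensity (hpos : ∀ x, 0 < ψ x) (hc : Continuous ψ) :
    Continuous (radialDensity κ ψ) :=
  (hc.comp continuous_norm).inv₀ fun x => (hpos ‖x‖).ne'

lemma integral_radialMeasure {F : Type*} [NormedAddCommGroup F] [NormedSpace ℝ F]
    (hpos : ∀ x, 0 < ψ x) (hc : Continuous ψ) (f : EuclideanSpace ℝ (Fin κ) → F) :
    ∫ x, f x ∂radialMeasure κ ψ = ∫ x, (ψ ‖x‖)⁻¹ • f x := by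
  rw [radialMeasure, integral_withDensity_eq_integral_toReal_smul
    (continuous_radialDensity hpos hc).measurable.ennreal_ofReal (by simp)]
  simp [radialDensity, ENNReal.toReal_ofReal, (hpos _).le]

lemma lintegral_radialMeasure (hpos : ∀ x, 0 < ψ x) (hc : Continuous ψ)
    (f : EuclideanSpace ℝ (Fin κ) → ℝ≥0∞) :
    ∫⁻ x, f x ∂radialMeasure κ ψ = ∫⁻ x, ENNReal.ofReal (ψ ‖x‖)⁻¹ * f x := by
  rw [radialMeasure, lintegral_withDensity_eq_lintegral_mul_non_measurable _
    (continuous_radialDensity hpos hc).measurable.ennreal_ofReal (by simp)]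
  rfl

lemma integral_comp_add_radialMeasure {F : Type*} [NormedAddCommGroup F] [NormedSpace ℝ F]
    (hpos : ∀ x, 0 < ψ x) (hc : Continuous ψ) (a : EuclideanSpace ℝ (Fin κ))
    (f : EuclideanSpace ℝ (Fin κ) → F) :
    ∫ x, f (x + a) ∂radialMeasure κ ψ =
      ∫ x, (ψ ‖x‖ / ψ ‖x - a‖) • f x ∂radialMeasure κ ψ := by
  rw [integral_radialMeasure hpos hc, integral_radialMeasure hpos hc,
    ← integral_sub_right_eq_self _ a]
  refine integral_congr_ae (.of_forall fun x => ?_)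
  have := (hpos ‖x‖).ne'
  simp only [sub_add_cancel, smul_smul]
  congr 1
  field_simp

lemma ae_radialMeasure (hpos : ∀ x, 0 < ψ x) (hc : Continuous ψ) :
    ae (radialMeasure κ ψ) = ae volume :=
  le_antisymm (withDensity_absolutelyContinuous _ _).ae_le
    (withDensity_absolutelyContinuous'
      (continuous_radialDensity hpos hc).measurable.ennreal_ofReal.aemeasurable
      (.of_forall fun x => by simpa [radialDensity] using hpos ‖x‖)).ae_le

lemma quasiMeasurePreserving_add_radialMeasure (hpos : ∀ x, 0 < ψ x) (hc : Continuous ψ)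
    (a : EuclideanSpace ℝ (Fin κ)) :
    Measure.QuasiMeasurePreserving (fun x => x + a) (radialMeasure κ ψ) (radialMeasure κ ψ) := by
  have h := quasiMeasurePreserving_add_right (volume : Measure (EuclideanSpace ℝ (Fin κ))) a
  have h1 := withDensity_absolutelyContinuous (volume : Measure (EuclideanSpace ℝ (Fin κ)))
    fun x => ENNReal.ofReal (radialDensity κ ψ x)
  refine h.mono h1 ?_
  rw [← Measure.ae_le_iff_absolutelyContinuous, ← ae_radialMeasure hpos hc]

/-- The translated measure has density `ψ ‖x‖ / ψ ‖x - a‖` relative to the original one. -/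
lemma map_add_radialMeasure_le (hpos : ∀ x, 0 < ψ x) (hc : Continuous ψ)
    {a : EuclideanSpace ℝ (Fin κ)} {M : ℝ}
    (hM : ∀ x : EuclideanSpace ℝ (Fin κ), ψ ‖x‖ ≤ M * ψ ‖x - a‖) :
    (radialMeasure κ ψ).map (fun x => x + a) ≤ ENNReal.ofReal M • radialMeasure κ ψ := by
  refine Measure.le_iff.2 fun s hs => ?_
  have hs' : MeasurableSet ((fun x => x + a) ⁻¹' s) := hs.preimage (by fun_prop)
  rw [Measure.map_apply (by fun_prop) hs, Measure.smul_apply, smul_eq_mul,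
    ← lintegral_indicator_one hs, ← lintegral_indicator_one hs', lintegral_radialMeasure hpos hc,
    lintegral_radialMeasure hpos hc, ← lintegral_const_mul' _ _ ENNReal.ofReal_ne_top,
    ← lintegral_sub_right_eq_self _ a]
  refine lintegral_mono fun x => ?_
  have hM0 : 0 ≤ M := by
    have := (hpos _).trans_le (hM 0)
    exact (pos_of_mul_pos_left this (hpos _).le).le
  have : (ψ ‖x - a‖)⁻¹ ≤ M * (ψ ‖x‖)⁻¹ := by
    rw [← div_eq_mul_inv, inv_eq_one_div, div_le_div_iff₀ (hpos _) (hpos _)]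
    linarith [hM x]
  rw [← mul_assoc, ← ENNReal.ofReal_mul hM0]
  have e : Set.indicator ((fun x => x + a) ⁻¹' s) (1 : EuclideanSpace ℝ (Fin κ) → ℝ≥0∞) (x - a)
      = s.indicator 1 x := by
    have hm : x - a ∈ (fun x => x + a) ⁻¹' s ↔ x ∈ s := by
      rw [Set.mem_preimage, sub_add_cancel]
    by_cases h : x ∈ s
    · rw [Set.indicator_of_mem (hm.2 h), Set.indicator_of_mem h]; rfl
    · rw [Set.indicator_of_notMem (mt hm.1 h), Set.indicator_of_notMem h]
  rw [e]
  gcongr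

lemma memLp_comp_add_radialMeasure {p : ℝ≥0∞} (hpos : ∀ x, 0 < ψ x) (hc : Continuous ψ)
    {a : EuclideanSpace ℝ (Fin κ)} {M : ℝ}
    (hM : ∀ x : EuclideanSpace ℝ (Fin κ), ψ ‖x‖ ≤ M * ψ ‖x - a‖)
    {f : EuclideanSpace ℝ (Fin κ) → ℂ} (hf : MemLp f p (radialMeasure κ ψ)) :
    MemLp (fun x => f (x + a)) p (radialMeasure κ ψ) :=
  (hf.of_measure_le_smul ENNReal.ofReal_ne_top
    (map_add_radialMeasure_le hpos hc hM)).comp_of_map (by fun_prop)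

lemma exists_isCompositionOperator_add (hpos : ∀ x, 0 < ψ x) (hc : Continuous ψ)
    {a : EuclideanSpace ℝ (Fin κ)} {M : ℝ}
    (hM : ∀ x : EuclideanSpace ℝ (Fin κ), ψ ‖x‖ ≤ M * ψ ‖x - a‖) :
    ∃ C : Lp ℂ 2 (radialMeasure κ ψ) →L[ℂ] Lp ℂ 2 (radialMeasure κ ψ),
      IsCompositionOperator (radialMeasure κ ψ) (fun x => x + a) C := by
  have hq := quasiMeasurePreserving_add_radialMeasure (κ := κ) hpos hc a
  have hmem : ∀ f : Lp ℂ 2 (radialMeasure κ ψ), MemLp (fun x => f (x + a)) 2 (radialMeasure κ ψ) :=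
    fun f => memLp_comp_add_radialMeasure hpos hc hM (Lp.memLp f)
  let T : Lp ℂ 2 (radialMeasure κ ψ) →ₗ[ℂ] Lp ℂ 2 (radialMeasure κ ψ) :=
    { toFun := fun f => (hmem f).toLp _
      map_add' := fun f g => by
        refine (MemLp.toLp_congr _ ((hmem f).add (hmem g)) ?_).trans (MemLp.toLp_add _ _)
        filter_upwards [hq.ae (Lp.coeFn_add f g)] with x hx using hx
      map_smul' := fun c f => by
        refine (MemLp.toLp_congr _ ((hmem f).const_smul c) ?_).trans
          (MemLp.toLp_const_smul _ _)
        filter_upwards [hq.ae (Lp.coeFn_smul c f)] with x hx using hx }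
  refine ⟨T.mkContinuous ((ENNReal.ofReal M) ^ (1 / (2 : ℝ≥0∞)).toReal).toReal fun f => ?_,
    fun f hf => ?_⟩
  · change ‖(hmem f).toLp _‖ ≤ _
    have hle := map_add_radialMeasure_le (κ := κ) hpos hc hM
    rw [Lp.norm_toLp, Lp.norm_def, ← ENNReal.toReal_mul]
    refine ENNReal.toReal_mono (ENNReal.mul_ne_top (by simp) (Lp.eLpNorm_ne_top f)) ?_
    rw [← smul_eq_mul, ← eLpNorm_smul_measure_of_ne_top (by simp)]
    refine le_trans (le_of_eq ?_) (eLpNorm_mono_measure _ hle)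
    rw [eLpNorm_map_measure]
    · rfl
    · exact ((Lp.memLp f).of_measure_le_smul ENNReal.ofReal_ne_top hle).1
    · fun_prop
  · change ((hmem (hf.toLp f)).toLp _ : EuclideanSpace ℝ (Fin κ) → ℂ) =ᵐ[_] _
    filter_upwards [MemLp.coeFn_toLp (hmem (hf.toLp f)), hq.ae hf.coeFn_toLp] with x hx hx'
    rw [hx, hx']
    rfl

/-! ### Powers, adjoint and norm formulas of the composition operator. -/

variable {a : EuclideanSpace ℝ (Fin κ)}
  {C : Lp ℂ 2 (radialMeasure κ ψ) →L[ℂ] Lp ℂ 2 (radialMeasure κ ψ)}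

lemma IsCompositionOperator.coeFn {X : Type*} [MeasurableSpace X] {μ : Measure X} {T : X → X}
    {C : Lp ℂ 2 μ →L[ℂ] Lp ℂ 2 μ} (hC : IsCompositionOperator μ T C) (f : Lp ℂ 2 μ) :
    C f =ᵐ[μ] f ∘ T := by
  simpa using hC f (Lp.memLp f)

lemma IsCompositionOperator.pow (hpos : ∀ x, 0 < ψ x) (hc : Continuous ψ)
    (hC : IsCompositionOperator (radialMeasure κ ψ) (fun x => x + a) C) (n : ℕ) :
    IsCompositionOperator (radialMeasure κ ψ) (fun x => x + n • a) (C ^ n) := by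
  intro f hf
  induction n with
  | zero => simpa [Function.comp_def] using hf.coeFn_toLp
  | succ n ih =>
    rw [pow_succ', mul_apply_eq_comp]
    filter_upwards [hC.coeFn ((C ^ n) (hf.toLp f)),
      (quasiMeasurePreserving_add_radialMeasure hpos hc a).ae ih] with x hx hx'
    rw [hx, Function.comp_apply, hx']
    simp [succ_nsmul', add_assoc]

lemma adjoint_coeFn (hpos : ∀ x, 0 < ψ x) (hc : Continuous ψ)
    (hM : ∀ a, ∃ M : ℝ, ∀ x : EuclideanSpace ℝ (Fin κ), ψ ‖x‖ ≤ M * ψ ‖x - a‖)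
    (hC : IsCompositionOperator (radialMeasure κ ψ) (fun x => x + a) C)
    (g : Lp ℂ 2 (radialMeasure κ ψ)) :
    ContinuousLinearMap.adjoint C g =ᵐ[radialMeasure κ ψ]
      fun x => (ψ ‖x‖ / ψ ‖x - a‖) • g (x - a) := by
  obtain ⟨M, hMa⟩ := hM a
  obtain ⟨M', hMa'⟩ := hM (-a)
  have hg := memLp_comp_add_radialMeasure hpos hc hMa' (Lp.memLp g)
  simp only [← sub_eq_add_neg] at hg
  have hw : Continuous fun x : EuclideanSpace ℝ (Fin κ) => ψ ‖x‖ / ψ ‖x - a‖ :=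
    (hc.comp continuous_norm).div (hc.comp (by fun_prop)) fun x => (hpos _).ne'
  have hmem : MemLp (fun x => (ψ ‖x‖ / ψ ‖x - a‖) • g (x - a)) 2 (radialMeasure κ ψ) := by
    refine hg.of_le_mul (c := M) (hw.aestronglyMeasurable.smul hg.1) (.of_forall fun x => ?_)
    rw [norm_smul, Real.norm_of_nonneg (div_nonneg (hpos _).le (hpos _).le)]
    gcongr
    rw [div_le_iff₀ (hpos _)]
    exact hMa x
  suffices h : ContinuousLinearMap.adjoint C g = hmem.toLp _ by
    rw [h]; exact hmem.coeFn_toLp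
  refine ext_inner_right ℂ fun f => ?_
  rw [ContinuousLinearMap.adjoint_inner_left, L2.inner_def, L2.inner_def]
  have h1 : ∫ x, inner ℂ (g x) (C f x) ∂radialMeasure κ ψ =
      ∫ x, inner ℂ (g (x + a - a)) (f (x + a)) ∂radialMeasure κ ψ := by
    refine integral_congr_ae ?_
    filter_upwards [hC.coeFn f] with x hx
    rw [hx, add_sub_cancel_right]; rfl
  rw [h1, integral_comp_add_radialMeasure hpos hc a fun x => inner ℂ (g (x - a)) (f x)]
  refine integral_congr_ae ?_
  filter_upwards [hmem.coeFn_toLp] with x hx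
  rw [hx, ← Complex.coe_smul, ← Complex.coe_smul, inner_smul_left, Complex.conj_ofReal,
    smul_eq_mul]

lemma L2.norm_sq_eq_integral {X : Type*} [MeasurableSpace X] {μ : Measure X} (f : Lp ℂ 2 μ) :
    ‖f‖ ^ 2 = ∫ x, ‖f x‖ ^ 2 ∂μ := by
  have h := L2.inner_def (𝕜 := ℂ) f f
  simp only [inner_self_eq_norm_sq_to_K] at h
  rw [← Complex.ofReal_inj]
  push_cast
  simp at h
  rw [h, ← integral_complex_ofReal]
  simp

lemma norm_sq_apply (hpos : ∀ x, 0 < ψ x) (hc : Continuous ψ)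
    (hC : IsCompositionOperator (radialMeasure κ ψ) (fun x => x + a) C)
    (f : Lp ℂ 2 (radialMeasure κ ψ)) :
    ‖C f‖ ^ 2 = ∫ x, (ψ ‖x‖ / ψ ‖x - a‖) * ‖f x‖ ^ 2 ∂radialMeasure κ ψ := by
  rw [L2.norm_sq_eq_integral]
  refine Eq.trans (integral_congr_ae ?_)
    (integral_comp_add_radialMeasure hpos hc a fun x => ‖f x‖ ^ 2)
  filter_upwards [hC.coeFn f] with x hx
  rw [hx]; rfl

lemma norm_sq_adjoint_apply (hpos : ∀ x, 0 < ψ x) (hc : Continuous ψ)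
    (hM : ∀ a, ∃ M : ℝ, ∀ x : EuclideanSpace ℝ (Fin κ), ψ ‖x‖ ≤ M * ψ ‖x - a‖)
    (hC : IsCompositionOperator (radialMeasure κ ψ) (fun x => x + a) C)
    (f : Lp ℂ 2 (radialMeasure κ ψ)) :
    ‖ContinuousLinearMap.adjoint C f‖ ^ 2 =
      ∫ x, (ψ ‖x + a‖ / ψ ‖x‖) * ‖f x‖ ^ 2 ∂radialMeasure κ ψ := by
  rw [L2.norm_sq_eq_integral]
  -- Shifting back by `-a` brings in the factor `ψ ‖x‖ / ψ ‖x + a‖`, which cancels one power of the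
  -- squared weight.
  have h := integral_comp_add_radialMeasure (κ := κ) hpos hc (-a)
    fun x => (ψ ‖x + a‖ / ψ ‖x‖) ^ 2 * ‖f x‖ ^ 2
  refine (integral_congr_ae ?_).trans (h.trans (integral_congr_ae (.of_forall fun x => ?_)))
  · filter_upwards [adjoint_coeFn hpos hc hM hC f] with x hx
    rw [hx, norm_smul, mul_pow, Real.norm_of_nonneg (div_nonneg (hpos _).le (hpos _).le)]
    simp [← sub_eq_add_neg]
  · have h1 := (hpos ‖x‖).ne'
    have h2 := (hpos ‖x + a‖).ne'
    simp only [sub_neg_eq_add, smul_eq_mul]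
    field_simp

lemma integrable_mul_norm_sq (hpos : ∀ x, 0 < ψ x) (hc : Continuous ψ)
    {b c : EuclideanSpace ℝ (Fin κ)} {M : ℝ}
    (hM : ∀ x : EuclideanSpace ℝ (Fin κ), ψ ‖x + b‖ ≤ M * ψ ‖x + c‖)
    (f : Lp ℂ 2 (radialMeasure κ ψ)) :
    Integrable (fun x => (ψ ‖x + b‖ / ψ ‖x + c‖) * ‖f x‖ ^ 2) (radialMeasure κ ψ) := by
  refine Integrable.bdd_mul (c := M) ((Lp.memLp f).integrable_norm_pow (by simp))
    (Continuous.aestronglyMeasurable ?_) (.of_forall fun x => ?_)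
  · exact (hc.comp (by fun_prop)).div (hc.comp (by fun_prop)) fun x => (hpos _).ne'
  · rw [Real.norm_of_nonneg (div_nonneg (hpos _).le (hpos _).le), div_le_iff₀ (hpos _)]
    exact hM x

lemma isCohyponormal_of_sq_le_mul (hpos : ∀ x, 0 < ψ x) (hc : Continuous ψ)
    (hM : ∀ a, ∃ M : ℝ, ∀ x : EuclideanSpace ℝ (Fin κ), ψ ‖x‖ ≤ M * ψ ‖x - a‖)
    (hsq : ∀ x : EuclideanSpace ℝ (Fin κ), ψ ‖x‖ ^ 2 ≤ ψ ‖x - a‖ * ψ ‖x + a‖)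
    (hC : IsCompositionOperator (radialMeasure κ ψ) (fun x => x + a) C) : IsCohyponormal C := by
  refine isCohyponormal_of_norm_sq_le fun f => ?_
  rw [norm_sq_apply hpos hc hC, norm_sq_adjoint_apply hpos hc hM hC]
  obtain ⟨M, hM1⟩ := hM a
  refine integral_mono ?_ ?_ fun x => ?_
  · simpa [sub_eq_add_neg] using integrable_mul_norm_sq hpos hc (b := 0) (c := -a) (M := M)
      (by simpa [sub_eq_add_neg] using hM1) f
  · simpa using integrable_mul_norm_sq hpos hc (b := a) (c := 0) (M := M)
      (fun x => by simpa using hM1 (x + a)) f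
  · dsimp only
    refine mul_le_mul_of_nonneg_right ?_ (sq_nonneg _)
    rw [div_le_div_iff₀ (hpos _) (hpos _)]
    linarith [hsq x]


/-! ### From cosubnormality to pointwise positivity of Hankel forms. -/

lemma nonneg_of_integral_mul_norm_sq_nonneg (hpos : ∀ x, 0 < ψ x) (hc : Continuous ψ)
    {G : EuclideanSpace ℝ (Fin κ) → ℝ} (hG : Continuous G)
    (hint : ∀ f : Lp ℂ 2 (radialMeasure κ ψ), 0 ≤ ∫ x, G x * ‖f x‖ ^ 2 ∂radialMeasure κ ψ)
    (x : EuclideanSpace ℝ (Fin κ)) : 0 ≤ G x := by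
  by_contra! hx
  have : IsLocallyFiniteMeasure (radialMeasure κ ψ) :=
    IsLocallyFiniteMeasure.withDensity_ofReal (continuous_radialDensity hpos hc)
  obtain ⟨r, hr, hB⟩ := Metric.isOpen_iff.1 (isOpen_lt hG continuous_const) x hx
  set B := Metric.ball x r
  have hBfin : radialMeasure κ ψ B ≠ ∞ := measure_ball_lt_top.ne
  have hBpos : 0 < radialMeasure κ ψ B := by
    rw [pos_iff_ne_zero]
    intro h0
    have : volume B = 0 := (measure_eq_zero_iff_ae_notMem.trans
      (by rw [ae_radialMeasure hpos hc])).1 h0 |> measure_eq_zero_iff_ae_notMem.2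
    exact (Metric.measure_ball_pos volume x hr).ne' this
  -- If `G x < 0`, then `G < 0` on a ball of positive finite measure, whose indicator contradicts
  -- `hint`.
  have h := hint (indicatorConstLp 2 measurableSet_ball hBfin 1)
  have e : ∫ x, G x * ‖indicatorConstLp 2 measurableSet_ball hBfin (1 : ℂ) x‖ ^ 2 ∂radialMeasure κ ψ
      = ∫ x in B, G x ∂radialMeasure κ ψ := by
    rw [← integral_indicator measurableSet_ball]
    refine integral_congr_ae ?_
    filter_upwards [indicatorConstLp_coeFn (p := 2) (hs := measurableSet_ball) (hμs := hBfin)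
      (c := (1 : ℂ))] with y hy
    rw [hy]
    by_cases hyB : y ∈ Metric.ball x r <;> simp only [Set.indicator, hyB] <;> simp
  rw [e] at h
  have hneg : 0 < ∫ x in B, -G x ∂radialMeasure κ ψ := by
    rw [setIntegral_pos_iff_support_of_nonneg_ae]
    · convert hBpos using 2
      refine Set.inter_eq_right.2 fun y hy => ?_
      have := hB hy
      simpa using this.ne
    · filter_upwards [ae_restrict_mem measurableSet_ball] with y hy
      have : G y < 0 := hB hy
      simpa using this.le
    · exact (hG.neg.continuousOn.integrableOn_compact (isCompact_closedBall x r)).mono_set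
        Metric.ball_subset_closedBall
  rw [integral_neg] at hneg
  linarith

/-- Since `(C*)^n = (C^n)*` and `C^n` is translation by `n • a`, the Hankel form of the orbit of `f`
under `C*` is an integral against `|f|²`; as `f` is arbitrary, the integrand weight is nonnegative
everywhere. -/
theorem IsCosubnormal.sum_mul_nonneg (hpos : ∀ x, 0 < ψ x) (hc : Continuous ψ)
    (hM : ∀ a, ∃ M : ℝ, ∀ x : EuclideanSpace ℝ (Fin κ), ψ ‖x‖ ≤ M * ψ ‖x - a‖)
    (hC : IsCompositionOperator (radialMeasure κ ψ) (fun x => x + a) C) (hS : IsCosubnormal C)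
    (s : Finset ℕ) (c : ℕ → ℝ) (x : EuclideanSpace ℝ (Fin κ)) :
    0 ≤ ∑ j ∈ s, ∑ k ∈ s, c j * c k * ψ ‖x + (j + k) • a‖ := by
  have key : 0 ≤ ∑ j ∈ s, ∑ k ∈ s, c j * c k * (ψ ‖x + (j + k) • a‖ / ψ ‖x‖) := by
    refine nonneg_of_integral_mul_norm_sq_nonneg hpos hc
      (G := fun x => ∑ j ∈ s, ∑ k ∈ s, c j * c k * (ψ ‖x + (j + k) • a‖ / ψ ‖x‖)) ?_
      (fun f => ?_) x
    · refine continuous_finsetSum _ fun j _ => continuous_finsetSum _ fun k _ =>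
        continuous_const.mul ?_
      exact (hc.comp (by fun_prop)).div (hc.comp (by fun_prop)) fun x => (hpos _).ne'
    · have hi : ∀ n : ℕ, Integrable (fun x => ψ ‖x + n • a‖ / ψ ‖x‖ * ‖f x‖ ^ 2)
          (radialMeasure κ ψ) := fun n => by
        obtain ⟨M, h⟩ := hM (n • a)
        simpa using integrable_mul_norm_sq hpos hc (b := n • a) (c := 0) (M := M)
          (fun x => by simpa using h (x + n • a)) f
      have := IsSubnormal.sum_norm_sq_pow_nonneg hS f s c
      convert this using 1
      simp only [Finset.sum_mul, mul_assoc]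
      rw [integral_finsetSum _ fun j _ => integrable_finsetSum _ fun k _ =>
        ((hi (j + k)).const_mul _).const_mul _]
      refine Finset.sum_congr rfl fun j _ => ?_
      rw [integral_finsetSum _ fun k _ => ((hi (j + k)).const_mul _).const_mul _]
      refine Finset.sum_congr rfl fun k _ => ?_
      rw [integral_const_mul, integral_const_mul, ← norm_sq_adjoint_apply hpos hc hM
        (hC.pow hpos hc (j + k)), ← ContinuousLinearMap.star_eq_adjoint, star_pow,
        ContinuousLinearMap.star_eq_adjoint]
  have e : ∑ j ∈ s, ∑ k ∈ s, c j * c k * ψ ‖x + (j + k) • a‖ =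
      ψ ‖x‖ * ∑ j ∈ s, ∑ k ∈ s, c j * c k * (ψ ‖x + (j + k) • a‖ / ψ ‖x‖) := by
    simp only [Finset.mul_sum]
    refine Finset.sum_congr rfl fun j _ => Finset.sum_congr rfl fun k _ => ?_
    have := (hpos ‖x‖).ne'
    field_simp
  rw [e]
  exact mul_nonneg (hpos _).le key

end Measure

theorem proposition3p3p3 (κ : ℕ) (hκ : 1 ≤ κ) (δ : ℝ)
    (hδ : 2 * Real.cosh Real.pi / (Real.cosh Real.pi - 1) ≤ δ)
    (ψ : ℝ → ℝ) (hψ : ∀ x : ℝ, ψ x = Real.cosh x + Real.cos x + δ) :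
    ((∀ x : ℝ, 0 < ψ x) ∧ Continuous ψ ∧ (∀ x : ℝ, ψ (-x) = ψ x) ∧ MemClassH 4 ψ) ∧
    (∀ a : EuclideanSpace ℝ (Fin κ),
      ∃ C : Lp ℂ 2 (radialMeasure κ ψ) →L[ℂ] Lp ℂ 2 (radialMeasure κ ψ),
        IsCompositionOperator (radialMeasure κ ψ) (fun x => x + a) C ∧ IsCohyponormal C) ∧
    (∃ ε : ℝ, 0 < ε ∧ ∀ a : EuclideanSpace ℝ (Fin κ), 0 < ‖a‖ → ‖a‖ < ε →
      ∀ C : Lp ℂ 2 (radialMeasure κ ψ) →L[ℂ] Lp ℂ 2 (radialMeasure κ ψ),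
        IsCompositionOperator (radialMeasure κ ψ) (fun x => x + a) C → ¬ IsCosubnormal C) := by
  have h2 := two_le_of_cosh_pi_div_le hδ
  have hfun : ψ = fun x => Real.cosh x + Real.cos x + δ := funext hψ
  have hpos : ∀ x, 0 < ψ x := fun x => hψ x ▸ cosh_add_cos_add_pos h2 x
  have hc : Continuous ψ := by
    rw [hfun]; exact (Real.continuous_cosh.add Real.continuous_cos).add continuous_const
  have heven : ∀ x, ψ (-x) = ψ x := fun x => by simp [hψ]
  have hM : ∀ a, ∃ M : ℝ, ∀ x : EuclideanSpace ℝ (Fin κ), ψ ‖x‖ ≤ M * ψ ‖x - a‖ := fun a => by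
    simpa only [hψ] using exists_cosh_add_cos_norm_le h2 a
  refine ⟨⟨hpos, hc, heven, hfun ▸ memClassH_cosh_add_cos (by linarith)⟩, fun a => ?_,
    2 * Real.pi, by positivity, fun a ha0 ha C hC hS => ?_⟩
  · obtain ⟨M, hMa⟩ := hM a
    obtain ⟨C, hC⟩ := exists_isCompositionOperator_add hpos hc hMa
    refine ⟨C, hC, isCohyponormal_of_sq_le_mul hpos hc hM (fun x => ?_) hC⟩
    simpa only [hψ] using sq_le_mul_cosh_add_cos_norm hδ x a
  · let c : ℕ → ℝ := fun n => if n = 0 then -1 else if n = 1 then 2 * Real.cosh ‖a‖ + 1 else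
      if n = 2 then -(2 * Real.cosh ‖a‖ + 1) else 1
    -- As `j + k` runs from `0` to `6`, the base point `-3a` centres the sample points at the
    -- origin; evenness of `ψ` then removes the absolute value in the norm.
    have h := hS.sum_mul_nonneg hpos hc hM hC (Finset.range 4) c ((-3 : ℝ) • a)
    have e : ∀ n : ℕ, ψ ‖(-3 : ℝ) • a + n • a‖ = ψ ((n - 3 : ℝ) * ‖a‖) := fun n => by
      have habs : ∀ x, ψ |x| = ψ x := fun x => by
        rcases abs_choice x with h | h <;> rw [h]
        exact heven x
      rw [← Nat.cast_smul_eq_nsmul ℝ, ← add_smul, norm_smul, Real.norm_eq_abs, neg_add_eq_sub,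
        ← habs ((n - 3 : ℝ) * ‖a‖), abs_mul, abs_norm]
    simp only [e] at h
    rw [hankel_cosh_add_cos δ ‖a‖ ψ hψ c (by simp [c]) (by simp [c]) (by simp [c])
      (by simp [c])] at h
    have hcos : Real.cos ‖a‖ < 1 := by
      refine lt_of_le_of_ne (Real.cos_le_one _) fun h1 => ha0.ne' ?_
      exact (Real.cos_eq_one_iff_of_lt_of_lt (by linarith) ha).1 h1
    have hcosh := Real.one_le_cosh ‖a‖
    have : 0 < (1 - Real.cos ‖a‖) * (Real.cosh ‖a‖ - Real.cos ‖a‖) ^ 2 :=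
      mul_pos (by linarith) (pow_pos (by linarith) 2)
    linarith
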